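/- Let $\mathbb{Z}\langle c,d\rangle$ be the ring of polynomials in noncommuting variables $c,d$ with $\deg c=1$, $\deg d=2$. For a finite graded poset $P$ of rank $n+1$ with minimum $\hat 0$ and maximum $\hat 1$ and $S\subseteq[n]=\{1,\dots,n\}$, let $f_S(P)$ be the number of chains of $P$ whose set of ranks is $S$, let $h_S(P)=\sum_{T\subseteq S}(-1)^{|S\setminus T|}f_T(P)$, and let $\Psi_P(a,b)=\sum_{S\subseteq[n]}h_S(P)\,u_1\cdots u_n$ (noncommuting $a,b$), where $u_i=b$ if $i\in S$ and $u_i=a$ otherwise. A $cd$-index of $P$ is a polynomial $\Phi_P\in\mathbb{Z}\langle c,d\rangle$ with $\Phi_P(a+b,ab+ba)=\Psi_P(a,b)$. Let $\sigma_0,\dots,\sigma_n$ be the facets of the boundary of the $n$-simplex. For $0\le i\le n-1$ let $\Gamma_i^n$ be the simplicial complex (an $(n-1)$-ball) generated by $\sigma_0,\dots,\sigma_i$, let $\Lambda_i^n$ be its semisuspension, i.e. the CW complex obtained from $\Gamma^n_i$ by attaching one new $(n-1)$-cell along $\partial\Gamma_i^n$, and let $P(\Lambda_i^n)$ be the face poset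 of $\Lambda_i^n$ (including the empty face) with a maximum $\hat 1$ adjoined. Let $\Phi_{\Lambda_i^n}$ be the $cd$-index of $P(\Lambda_i^n)$. Put $\check\Phi_0^n=\Phi_{\Lambda_0^n}$ and $\check\Phi_j^n=\Phi_{\Lambda_j^n}-\Phi_{\Lambda_{j-1}^n}$ for $1\le j\le n-1$. Write $[v]\Phi$ for the coefficient of a monomial $v$ in $\Phi$. **Theorem.** Let $n\ge 4$. For every $0\le i\le n-1$ the poset $P(\Lambda_i^n)$ has a unique $cd$-index, so that the polynomials $\check\Phi_j^n$ are well defined. Let $w$ be a $cd$-monomial with $m$ occurrences of the letter $d$. Then: 1. If $\deg w=n-1$, then $[wc]\check\Phi_0^n\ge 2^m$. 2. If $n\ge 5$, $1\le j\le n-1$ and $\deg w=n-2$, then $[wd]\check\Phi_j^n\ge 2^m$. -/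

import Mathlib

/-- The two noncommuting variables `c` and `d`. -/
inductive CDLetter
  | c
  | d
  deriving DecidableEq

/-- The two noncommuting variables `a` and `b`. -/
inductive ABLetter
  | a
  | b
  deriving DecidableEq

/-- A `cd`-monomial: a word in the letters `c` and `d`. -/
abbrev CDMonomial := FreeMonoid CDLetter

/-- `ℤ⟨c,d⟩`, polynomials in the noncommuting variables `c`, `d`. -/
abbrev CDPoly := MonoidAlgebra ℤ CDMonomial

/-- `ℤ⟨a,b⟩`, polynomials in the noncommuting variables `a`, `b`. -/
abbrev ABPoly := MonoidAlgebra ℤ (FreeMonoid ABLetter)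

/-- The degree of a letter: `deg c = 1`, `deg d = 2`. -/
def CDLetter.deg : CDLetter → ℕ
  | .c => 1
  | .d => 2

/-- The degree of a `cd`-monomial, with `deg c = 1` and `deg d = 2`. -/
def cdDegree (w : CDMonomial) : ℕ := (w.toList.map CDLetter.deg).sum

/-- The number of occurrences of the letter `d` in a `cd`-monomial. -/
def dCount (w : CDMonomial) : ℕ := w.toList.count CDLetter.d

/-- `[w]Φ`, the coefficient of the monomial `w` in `Φ`. -/
def cdCoeff (w : CDMonomial) (Φ : CDPoly) : ℤ := Φ.coeff w

noncomputable section

/-- The variable `a`, resp. `b`, as an element of `ℤ⟨a,b⟩`. -/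
def abVar (x : ABLetter) : ABPoly := MonoidAlgebra.of ℤ (FreeMonoid ABLetter) (FreeMonoid.of x)

/-- The values substituted for `c` and `d`: `c ↦ a + b` and `d ↦ ab + ba`. -/
def cdLetterToAB : CDLetter → ABPoly
  | .c => abVar .a + abVar .b
  | .d => abVar .a * abVar .b + abVar .b * abVar .a

/-- The substitution `Φ(c,d) ↦ Φ(a+b, ab+ba)`. -/
def cdToAB : CDPoly →ₐ[ℤ] ABPoly :=
  MonoidAlgebra.lift ℤ ABPoly CDMonomial (FreeMonoid.lift cdLetterToAB)

section FlagVectors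

variable (P : Type*) [PartialOrder P] [BoundedOrder P] [GradeMinOrder ℕ P]

/-- The number `n` such that the graded poset `P` has rank `n + 1`. -/
def innerRank : ℕ := grade ℕ (⊤ : P) - 1

/-- The flag `f`-vector: the number of chains of `P` whose set of ranks is `S`. For `S ⊆ [n]`, where
`P` has rank `n + 1`, such chains avoid the minimum and the maximum of `P`. -/
def flagF (S : Finset ℕ) : ℕ :=
  Set.ncard {C : Finset P | IsChain (· ≤ ·) (C : Set P) ∧ C.image (grade ℕ) = S}

/-- The flag `h`-vector: `h_S = ∑_{T ⊆ S} (-1)^{|S ∖ T|} f_T`. -/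
def flagH (S : Finset ℕ) : ℤ :=
  ∑ T ∈ S.powerset, (-1) ^ (S \ T).card * (flagF P T : ℤ)

/-- The word `u_S = u_1 u_2 ⋯ u_n` with `u_i = b` if `i ∈ S` and `u_i = a` otherwise. -/
def abWord (n : ℕ) (S : Finset ℕ) : FreeMonoid ABLetter :=
  FreeMonoid.ofList ((List.range' 1 n).map fun i => if i ∈ S then ABLetter.b else ABLetter.a)

/-- The `ab`-polynomial `Ψ_P(a,b) = ∑_{S ⊆ [n]} h_S(P) u_S` of a poset `P` of rank `n + 1`. -/
def abPolynomial : ABPoly :=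
  ∑ S ∈ (Finset.Icc 1 (innerRank P)).powerset,
    MonoidAlgebra.single (abWord (innerRank P) S) (flagH P S)

/-- `Φ` is a `cd`-index of `P`: `Φ(a+b, ab+ba) = Ψ_P(a,b)`. -/
def IsCDIndex (Φ : CDPoly) : Prop := cdToAB Φ = abPolynomial P

open Classical in
/-- The `cd`-index of `P` (with value `0` if there is none). -/
def cdIndex : CDPoly := if h : ∃ Φ, IsCDIndex P Φ then h.choose else 0

end FlagVectors

section Semisuspension

/-- The facet `σ_k` of the boundary of the `n`-simplex on the vertices `0, …, n`: all vertices
except `k`. -/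
def simplexFacet (n : ℕ) (k : Fin (n + 1)) : Finset (Fin (n + 1)) := Finset.univ.erase k

/-- The simplicial complex `Γ_i^n` generated by `σ_0, …, σ_i` (the empty face included). -/
def gammaFaces (n : ℕ) (i : Fin n) : Set (Finset (Fin (n + 1))) :=
  {F | ∃ k : Fin (n + 1), (k : ℕ) ≤ (i : ℕ) ∧ F ⊆ simplexFacet n k}

/-- The boundary complex of a simplicial ball all of whose facets have `n` vertices: the faces
contained in some face with `n - 1` vertices that lies in exactly one facet. -/
def ballBoundary {V : Type*} (n : ℕ) (Γ : Set (Finset V)) : Set (Finset V) :=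
  {F | ∃ G ∈ Γ, G.card + 1 = n ∧ F ⊆ G ∧ ∃! H, H ∈ Γ ∧ H.card = n ∧ G ⊆ H}

/-- The elements of the augmented face poset `P(Λ_i^n)` of the semisuspension `Λ_i^n` of `Γ_i^n`:
the faces of `Γ_i^n`, the additional `(n-1)`-cell `τ`, and the adjoined maximum. -/
inductive LambdaPoset (n : ℕ) (i : Fin n)
  | face (F : Finset (Fin (n + 1))) (hF : F ∈ gammaFaces n i)
  | cell
  | top

namespace LambdaPoset

variable {n : ℕ} {i : Fin n}

/-- The poset is finite, so the counts of chains in it are genuine. -/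
instance : Finite (LambdaPoset n i) := by
  let f : LambdaPoset n i → Option (Option (Finset (Fin (n + 1)))) := fun x =>
    match x with
    | face F _ => some (some F)
    | cell => some none
    | top => none
  refine Finite.of_injective f ?_
  intro x y hxy
  cases x <;> cases y <;> simp_all [f]

/-- Faces are ordered by inclusion; a face lies below `τ` iff it is in the boundary of `Γ_i^n`;
everything lies below the adjoined maximum. -/
protected def le : LambdaPoset n i → LambdaPoset n i → Prop
  | face F _, face G _ => F ⊆ G
  | face F _, cell => F ∈ ballBoundary n (gammaFaces n i)
  | cell, face _ _ => False
  | cell, cell => True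
  | _, top => True
  | top, face _ _ => False
  | top, cell => False

instance : LE (LambdaPoset n i) := ⟨LambdaPoset.le⟩

theorem face_le_face {F G : Finset (Fin (n + 1))} {hF : F ∈ gammaFaces n i}
    {hG : G ∈ gammaFaces n i} : face F hF ≤ face G hG ↔ F ⊆ G := Iff.rfl

theorem face_le_cell {F : Finset (Fin (n + 1))} {hF : F ∈ gammaFaces n i} :
    face F hF ≤ cell ↔ F ∈ ballBoundary n (gammaFaces n i) := Iff.rfl

theorem not_cell_le_face {F : Finset (Fin (n + 1))} {hF : F ∈ gammaFaces n i} :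
    ¬ cell ≤ face F hF := id

theorem le_top' (x : LambdaPoset n i) : x ≤ top := by cases x <;> exact trivial

theorem not_top_le_face {F : Finset (Fin (n + 1))} {hF : F ∈ gammaFaces n i} :
    ¬ top ≤ face F hF := id

theorem not_top_le_cell : ¬ (top : LambdaPoset n i) ≤ cell := id

theorem boundary_mono {F G : Finset (Fin (n + 1))} (h : F ⊆ G)
    (hG : G ∈ ballBoundary n (gammaFaces n i)) : F ∈ ballBoundary n (gammaFaces n i) := by
  obtain ⟨R, hR, hc, hGR, hu⟩ := hG
  exact ⟨R, hR, hc, h.trans hGR, hu⟩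

theorem gamma_mono {F G : Finset (Fin (n + 1))} (h : F ⊆ G)
    (hG : G ∈ gammaFaces n i) : F ∈ gammaFaces n i := by
  obtain ⟨k, hk, hGk⟩ := hG
  exact ⟨k, hk, h.trans hGk⟩

theorem card_simplexFacet (k : Fin (n + 1)) : (simplexFacet n k).card = n := by
  simp [simplexFacet]

instance : PartialOrder (LambdaPoset n i) where
  le_refl x := by
    cases x with
    | face F hF => exact Finset.Subset.refl F
    | cell => exact trivial
    | top => exact trivial
  le_trans x y z hxy hyz := by
    cases x <;> cases y <;> cases z <;>
      first
      | exact trivial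
      | exact (hxy : False).elim
      | exact (hyz : False).elim
      | exact hxy
      | exact hyz
      | exact Finset.Subset.trans hxy hyz
      | exact boundary_mono hxy hyz
  le_antisymm x y hxy hyx := by
    cases x <;> cases y <;>
      first
      | rfl
      | exact (hxy : False).elim
      | exact (hyx : False).elim
      | (have h := Finset.Subset.antisymm hxy hyx; subst h; rfl)

theorem empty_mem_gamma : (∅ : Finset (Fin (n + 1))) ∈ gammaFaces n i :=
  ⟨0, by simp, Finset.empty_subset _⟩

theorem empty_mem_boundary :
    (∅ : Finset (Fin (n + 1))) ∈ ballBoundary n (gammaFaces n i) := by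
  have hi := i.isLt
  have h0 : (0 : Fin (n + 1)) ≠ Fin.last n := by
    intro h
    have := congrArg Fin.val h
    simp at this
    omega
  have hsub : (simplexFacet n 0).erase (Fin.last n) ⊆ simplexFacet n 0 := Finset.erase_subset _ _
  have hlast : Fin.last n ∈ simplexFacet n 0 := by simp [simplexFacet, h0.symm]
  refine ⟨(simplexFacet n 0).erase (Fin.last n), ⟨0, by simp, hsub⟩, ?_, Finset.empty_subset _,
    simplexFacet n 0, ⟨⟨0, by simp, Finset.Subset.refl _⟩, card_simplexFacet _, hsub⟩, ?_⟩
  · rw [Finset.card_erase_add_one hlast, card_simplexFacet]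
  · rintro H ⟨⟨k, hk, hHk⟩, hc, hGH⟩
    have hH : H = simplexFacet n k :=
      Finset.eq_of_subset_of_card_le hHk (by rw [card_simplexFacet, hc])
    by_cases hk0 : k = 0
    · rw [hH, hk0]
    · exfalso
      have hkl : k ≠ Fin.last n := by
        intro h
        rw [h] at hk
        simp at hk
        omega
      have : k ∈ H := hGH (by simp [simplexFacet, hk0, hkl])
      rw [hH] at this
      simp [simplexFacet] at this

instance : BoundedOrder (LambdaPoset n i) where
  top := top
  le_top := le_top'
  bot := face ∅ empty_mem_gamma
  bot_le x := by
    cases x with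
    | face F hF => exact Finset.empty_subset F
    | cell => exact empty_mem_boundary
    | top => exact trivial

/-- The rank function: a face `F` has rank `|F|`, the cell `τ` has rank `n` and the maximum has
rank `n + 1`. -/
def rk : LambdaPoset n i → ℕ
  | face F _ => F.card
  | cell => n
  | top => n + 1

theorem card_le_of_mem_gamma {F : Finset (Fin (n + 1))} (hF : F ∈ gammaFaces n i) :
    F.card ≤ n := by
  obtain ⟨k, -, h⟩ := hF
  exact (Finset.card_le_card h).trans (card_simplexFacet k).le

theorem rk_strictMono : StrictMono (rk : LambdaPoset n i → ℕ) := by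
  intro x y hxy
  obtain ⟨h1, h2⟩ := lt_iff_le_not_ge.1 hxy
  cases x with
  | face F hF =>
    cases y with
    | face G hG => exact Finset.card_lt_card ⟨h1, h2⟩
    | cell =>
      obtain ⟨G, -, hc, hFG, -⟩ := face_le_cell.1 h1
      have := Finset.card_le_card hFG
      simp only [rk]
      omega
    | top =>
      have := card_le_of_mem_gamma hF
      simp only [rk]
      omega
  | cell =>
    cases y with
    | face G hG => exact (not_cell_le_face h1).elim
    | cell => exact (h2 h1).elim
    | top => simp [rk]
  | top => exact (h2 (le_top' y)).elim

/-- `P(Λ_i^n)` is a graded poset with rank function `rk`. -/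
instance : GradeMinOrder ℕ (LambdaPoset n i) where
  grade := rk
  grade_strictMono := rk_strictMono
  covBy_grade := by
    intro x y hxy
    have hlt := rk_strictMono hxy.1
    obtain ⟨h1, h2⟩ := lt_iff_le_not_ge.1 hxy.1
    have key : ∀ z : LambdaPoset n i, x ≤ z → z ≤ y → rk x < rk z → ¬ rk z < rk y := by
      intro z hxz hzy hr hr'
      refine hxy.2 (lt_of_le_of_ne hxz ?_) (lt_of_le_of_ne hzy ?_)
      · rintro rfl
        exact lt_irrefl _ hr
      · rintro rfl
        exact lt_irrefl _ hr'
    rw [Order.covBy_iff_add_one_eq]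
    cases x with
    | face F hF =>
      cases y with
      | face G hG =>
        obtain ⟨v, hv, hvF⟩ := Finset.exists_of_ssubset (⟨h1, h2⟩ : F ⊂ G)
        have hsub : insert v F ⊆ G := Finset.insert_subset hv h1
        have := key (face (insert v F) (gamma_mono hsub hG)) (Finset.subset_insert v F) hsub
          (by simp [rk, Finset.card_insert_of_notMem hvF])
        simp only [rk, Finset.card_insert_of_notMem hvF] at this hlt ⊢
        omega
      | cell =>
        obtain ⟨G, hG, hc, hFG, hu⟩ := face_le_cell.1 h1
        have := key (face G hG) hFG ⟨G, hG, hc, Finset.Subset.refl G, hu⟩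
        simp only [rk] at this hlt ⊢
        have := Finset.card_le_card hFG
        omega
      | top =>
        obtain ⟨k, hk, hFk⟩ := hF
        have := key (face (simplexFacet n k) ⟨k, hk, Finset.Subset.refl _⟩) hFk (le_top' _)
        simp only [rk, card_simplexFacet] at this hlt ⊢
        have := Finset.card_le_card hFk
        rw [card_simplexFacet] at this
        omega
    | cell =>
      cases y with
      | face G hG => exact (not_cell_le_face h1).elim
      | cell => exact (h2 h1).elim
      | top => rfl
    | top => exact (h2 (le_top' y)).elim
  isMin_grade := by
    intro x hx
    have h : x = face ∅ empty_mem_gamma := by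
      apply le_antisymm
      · exact hx (show face ∅ empty_mem_gamma ≤ x from bot_le)
      · exact bot_le
    rw [h]
    simp [rk]

end LambdaPoset

end Semisuspension

/-- The `cd`-index `Φ_{Λ_i^n}` of the semisuspension `Λ_i^n`, for `0 ≤ i ≤ n - 1`. -/
def lambdaCDIndex (n i : ℕ) : CDPoly :=
  if h : i < n then cdIndex (LambdaPoset n ⟨i, h⟩) else 0

/-- The polynomials `Φ̌_j^n`: `Φ̌_0^n = Φ_{Λ_0^n}`, `Φ̌_j^n = Φ_{Λ_j^n} - Φ_{Λ_{j-1}^n}` for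
`1 ≤ j ≤ n - 1`, and `Φ̌_j^n = 0` for `j ≥ n`. -/
def checkPhi (n j : ℕ) : CDPoly :=
  if n ≤ j then 0
  else if j = 0 then lambdaCDIndex n 0
  else lambdaCDIndex n j - lambdaCDIndex n (j - 1)

end

/-! Let `D` be the derivation of `ℤ⟨c,d⟩` with `c ↦ d`, `d ↦ cd`, and let `B_r` be the Boolean
lattice of rank `r`. The theorem rests on the closed form `Φ̌_j^n = D^j(Φ(B_{n-j}) c)`, where
`Φ(B_{r+1}) = Φ(B_r) c + D Φ(B_r)`.

To obtain it, expand `Ψ_P` over chains: a chain has the letter `b` at its ranks and the factor `a -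
b` at the others. Sorting chains by their largest element leaves sums over faces, because lower
intervals of faces are Boolean. Adding the facet `σ_j` adds the faces of `σ_j` that contain the
vertices `0, …, j-1`. On the boundary these are exchanged for the faces of `σ_j` that contain all
vertices after `j`. The increment is thus built from "star sums" (`semisuspensionAB_succ`). The
derivation acts on star sums by simple rules, so the increment is the image of `D^j(Φ(B_{n-j}) c)`
(`cdToAB_checkCD`). Telescoping gives a `cd`-index, and injectivity of the substitution
(`cdToAB_injective`) makes it unique.

For the bounds, `D` preserves nonnegativity of coefficients. The polynomial `∑ 2^m w` equals the
Boolean `cd`-index in degree 3 and grows no faster under the pyramid recursion (`boolCD_sub_powCD`).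
This settles `j = 0`. For `j ≥ 1`, the part of `Φ̌_j^n` ending in `d` dominates `Φ(B_{n-1}) d`
(`checkCD_decomposition`). -/

/-! ### Derivations of free algebras -/

section FreeDerivation

variable {α : Type*}

/-- The algebra homomorphism `p ↦ p + ε δ(p)` attached to the derivation `δ` of `ℤ⟨α⟩` with
prescribed values on the variables. -/
noncomputable def dualLift (δ : α → MonoidAlgebra ℤ (FreeMonoid α)) :
    MonoidAlgebra ℤ (FreeMonoid α) →ₐ[ℤ] DualNumber (MonoidAlgebra ℤ (FreeMonoid α)) :=
  MonoidAlgebra.lift ℤ _ (FreeMonoid α) (FreeMonoid.lift fun x =>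
    TrivSqZeroExt.inl (MonoidAlgebra.of ℤ (FreeMonoid α) (FreeMonoid.of x))
      + TrivSqZeroExt.inr (δ x))

theorem fst_dualLift (δ : α → MonoidAlgebra ℤ (FreeMonoid α))
    (p : MonoidAlgebra ℤ (FreeMonoid α)) : (dualLift δ p).fst = p := by
  have h : (TrivSqZeroExt.fstHom ℤ (MonoidAlgebra ℤ (FreeMonoid α))
      (MonoidAlgebra ℤ (FreeMonoid α))).comp (dualLift δ) = AlgHom.id ℤ _ := by
    apply MonoidAlgebra.algHom_ext'
    · apply FreeMonoid.hom_eq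
      intro x
      simp [dualLift]
    · exact Subsingleton.elim _ _
  exact DFunLike.congr_fun h p

/-- The derivation of `ℤ⟨α⟩` with prescribed values on the variables. -/
noncomputable def freeDerivation (δ : α → MonoidAlgebra ℤ (FreeMonoid α)) :
    MonoidAlgebra ℤ (FreeMonoid α) →+ MonoidAlgebra ℤ (FreeMonoid α) where
  toFun p := (dualLift δ p).snd
  map_zero' := by simp
  map_add' p q := by simp

theorem freeDerivation_mul (δ : α → MonoidAlgebra ℤ (FreeMonoid α))
    (p q : MonoidAlgebra ℤ (FreeMonoid α)) :
    freeDerivation δ (p * q) = p * freeDerivation δ q + freeDerivation δ p * q := by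
  change (dualLift δ (p * q)).snd = _
  rw [map_mul, DualNumber.snd_mul, fst_dualLift, fst_dualLift]
  rfl

theorem freeDerivation_of (δ : α → MonoidAlgebra ℤ (FreeMonoid α)) (x : α) :
    freeDerivation δ (MonoidAlgebra.of ℤ (FreeMonoid α) (FreeMonoid.of x)) = δ x := by
  change (dualLift δ _).snd = _
  simp [dualLift]

theorem freeDerivation_one (δ : α → MonoidAlgebra ℤ (FreeMonoid α)) :
    freeDerivation δ 1 = 0 := by
  change (dualLift δ 1).snd = 0
  simp

end FreeDerivation

/-! ### Coefficients of words -/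

section Words

variable {α : Type*}

theorem FreeMonoid.of_mul_ne_one (x : α) (u : FreeMonoid α) : FreeMonoid.of x * u ≠ 1 := by
  intro h
  have := congrArg FreeMonoid.toList h
  simp at this

theorem coeff_of_mul_same (x : α) (p : MonoidAlgebra ℤ (FreeMonoid α)) (u : FreeMonoid α) :
    (MonoidAlgebra.of ℤ (FreeMonoid α) (FreeMonoid.of x) * p).coeff (FreeMonoid.of x * u)
      = p.coeff u := by
  rw [MonoidAlgebra.of_apply, MonoidAlgebra.coeff_single_mul_mul, one_mul]

theorem coeff_of_mul_ne {x y : α} (h : x ≠ y) (p : MonoidAlgebra ℤ (FreeMonoid α))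
    (u : FreeMonoid α) :
    (MonoidAlgebra.of ℤ (FreeMonoid α) (FreeMonoid.of x) * p).coeff (FreeMonoid.of y * u) = 0 := by
  rw [MonoidAlgebra.of_apply]
  refine MonoidAlgebra.coeff_single_mul_of_forall_mul_ne _ _ fun v hv => h ?_
  have := congrArg FreeMonoid.toList hv
  simp at this
  exact this.1

theorem coeff_of_mul_one (x : α) (p : MonoidAlgebra ℤ (FreeMonoid α)) :
    (MonoidAlgebra.of ℤ (FreeMonoid α) (FreeMonoid.of x) * p).coeff 1 = 0 := by
  rw [MonoidAlgebra.of_apply]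
  exact MonoidAlgebra.coeff_single_mul_of_forall_mul_ne _ _ fun v =>
    FreeMonoid.of_mul_ne_one x v

theorem coeff_mul_of_same (x : α) (p : MonoidAlgebra ℤ (FreeMonoid α)) (u : FreeMonoid α) :
    (p * MonoidAlgebra.of ℤ (FreeMonoid α) (FreeMonoid.of x)).coeff (u * FreeMonoid.of x)
      = p.coeff u := by
  rw [MonoidAlgebra.of_apply, MonoidAlgebra.coeff_mul_single_mul, mul_one]

theorem coeff_mul_of_ne {x y : α} (h : x ≠ y) (p : MonoidAlgebra ℤ (FreeMonoid α))
    (u : FreeMonoid α) :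
    (p * MonoidAlgebra.of ℤ (FreeMonoid α) (FreeMonoid.of x)).coeff (u * FreeMonoid.of y) = 0 := by
  rw [MonoidAlgebra.of_apply]
  refine MonoidAlgebra.coeff_mul_single_of_forall_mul_ne _ _ fun v hv => h ?_
  have := congrArg (fun w => (FreeMonoid.toList w).reverse) hv
  simp at this
  exact this.1

/-- The left quotient of a noncommutative polynomial by a variable. -/
noncomputable def leftQuot (x : α) (p : MonoidAlgebra ℤ (FreeMonoid α)) :
    MonoidAlgebra ℤ (FreeMonoid α) where
  coeff := p.coeff.comapDomain (FreeMonoid.of x * ·) (mul_right_injective _).injOn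

theorem coeff_leftQuot (x : α) (p : MonoidAlgebra ℤ (FreeMonoid α)) (u : FreeMonoid α) :
    (leftQuot x p).coeff u = p.coeff (FreeMonoid.of x * u) := rfl

end Words

/-! ### Uniqueness of the `cd`-index -/

noncomputable section

/-- The variable `c`, resp. `d`, as an element of `ℤ⟨c,d⟩`. -/
def cdVar (x : CDLetter) : CDPoly := MonoidAlgebra.of ℤ CDMonomial (FreeMonoid.of x)

theorem cdToAB_cdVar (x : CDLetter) : cdToAB (cdVar x) = cdLetterToAB x := by
  simp [cdToAB, cdVar]

theorem cdPoly_decomposition (p : CDPoly) :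
    p = MonoidAlgebra.single 1 (p.coeff 1) + cdVar .c * leftQuot .c p
      + cdVar .d * leftQuot .d p := by
  ext w
  simp only [MonoidAlgebra.coeff_add, Finsupp.add_apply, cdVar, MonoidAlgebra.coeff_single]
  induction w using FreeMonoid.casesOn with
  | one => simp only [coeff_of_mul_one]; simp
  | of_mul x u =>
    rw [Finsupp.single_eq_of_ne (FreeMonoid.of_mul_ne_one x u)]
    cases x
    · rw [coeff_of_mul_same, coeff_of_mul_ne (by simp), coeff_leftQuot]; simp
    · rw [coeff_of_mul_same, coeff_of_mul_ne (by simp), coeff_leftQuot]; simp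

/-- The words beginning with `a` and with `b` give `p + bq = 0` and `p + aq = 0`. Hence `aq = bq`,
which forces `q = 0` because no word begins with both letters. -/
theorem ab_split {k : ℤ} {p q : ABPoly}
    (h : MonoidAlgebra.single 1 k + (abVar .a + abVar .b) * p
      + (abVar .a * abVar .b + abVar .b * abVar .a) * q = 0) : k = 0 ∧ p = 0 ∧ q = 0 := by
  have h' : MonoidAlgebra.single 1 k + abVar .a * (p + abVar .b * q)
      + abVar .b * (p + abVar .a * q) = 0 := by rw [← h]; noncomm_ring
  have hw := fun w => congrArg (fun r : ABPoly => r.coeff w) h'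
  simp only [MonoidAlgebra.coeff_add, Finsupp.add_apply, abVar, MonoidAlgebra.coeff_single,
    MonoidAlgebra.coeff_zero, Finsupp.coe_zero, Pi.zero_apply] at hw
  have hk : k = 0 := by
    have := hw 1
    simp only [coeff_of_mul_one] at this
    simpa using this
  subst hk
  have ha : ∀ u, p.coeff u + (abVar .b * q).coeff u = 0 := by
    intro u
    have := hw (FreeMonoid.of .a * u)
    rw [coeff_of_mul_same, coeff_of_mul_ne (by simp)] at this
    simpa [abVar] using this
  have hb : ∀ u, p.coeff u + (abVar .a * q).coeff u = 0 := by
    intro u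
    have := hw (FreeMonoid.of .b * u)
    rw [coeff_of_mul_same, coeff_of_mul_ne (by simp)] at this
    simpa [abVar] using this
  have hq : q = 0 := by
    ext u
    have h1 := ha (FreeMonoid.of .b * u)
    have h2 := hb (FreeMonoid.of .b * u)
    rw [abVar, coeff_of_mul_same] at h1
    rw [abVar, coeff_of_mul_ne (by simp)] at h2
    simp only [MonoidAlgebra.coeff_zero, Finsupp.coe_zero, Pi.zero_apply]
    omega
  subst hq
  refine ⟨rfl, ?_, rfl⟩
  ext u
  simpa using ha u

/-- By `ab_split`, both left quotients of a kernel element lie again in the kernel, so each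
coefficient is reached by induction on its word. -/
theorem cdToAB_injective : Function.Injective cdToAB := by
  rw [injective_iff_map_eq_zero]
  have key : ∀ (w : CDMonomial) (p : CDPoly), cdToAB p = 0 → p.coeff w = 0 := by
    intro w
    induction w using FreeMonoid.inductionOn' with
    | one =>
      intro p hp
      rw [cdPoly_decomposition p] at hp
      simp only [map_add, map_mul, cdToAB_cdVar, cdLetterToAB] at hp
      rw [show cdToAB (MonoidAlgebra.single 1 (p.coeff 1)) = MonoidAlgebra.single 1 (p.coeff 1) by
        simp [cdToAB, MonoidAlgebra.one_def]] at hp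
      exact (ab_split hp).1
    | of_mul x u ih =>
      intro p hp
      rw [cdPoly_decomposition p] at hp
      simp only [map_add, map_mul, cdToAB_cdVar, cdLetterToAB] at hp
      rw [show cdToAB (MonoidAlgebra.single 1 (p.coeff 1)) = MonoidAlgebra.single 1 (p.coeff 1) by
        simp [cdToAB, MonoidAlgebra.one_def]] at hp
      obtain ⟨-, hc, hd⟩ := ab_split hp
      rw [← coeff_leftQuot]
      cases x
      · exact ih _ hc
      · exact ih _ hd
  intro p hp
  ext w
  exact key w p hp

/-! ### The pyramid recursion -/

/-- The derivation of `ℤ⟨c,d⟩` with `c ↦ d` and `d ↦ cd`. -/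
def cdDer : CDPoly →+ CDPoly :=
  freeDerivation fun
    | .c => cdVar .d
    | .d => cdVar .c * cdVar .d

/-- The derivation of `ℤ⟨a,b⟩` with `a ↦ ba` and `b ↦ ab`. -/
def abDer : ABPoly →+ ABPoly :=
  freeDerivation fun
    | .a => abVar .b * abVar .a
    | .b => abVar .a * abVar .b

theorem cdDer_mul (p q : CDPoly) : cdDer (p * q) = p * cdDer q + cdDer p * q :=
  freeDerivation_mul _ p q

theorem abDer_mul (p q : ABPoly) : abDer (p * q) = p * abDer q + abDer p * q :=
  freeDerivation_mul _ p q

theorem cdDer_c : cdDer (cdVar .c) = cdVar .d := freeDerivation_of _ _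

theorem cdDer_d : cdDer (cdVar .d) = cdVar .c * cdVar .d := freeDerivation_of _ _

theorem abDer_a : abDer (abVar .a) = abVar .b * abVar .a := freeDerivation_of _ _

theorem abDer_b : abDer (abVar .b) = abVar .a * abVar .b := freeDerivation_of _ _

theorem cdDer_one : cdDer 1 = 0 := freeDerivation_one _

theorem abDer_one : abDer 1 = 0 := freeDerivation_one _

theorem cdPoly_induction {motive : CDPoly → Prop} (zero : motive 0)
    (add : ∀ p q, motive p → motive q → motive (p + q)) (neg : ∀ p, motive p → motive (-p))
    (one : motive 1) (mul : ∀ x p, motive p → motive (cdVar x * p)) (p : CDPoly) : motive p := by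
  have word : ∀ w : CDMonomial, motive (MonoidAlgebra.of ℤ CDMonomial w) := by
    intro w
    induction w using FreeMonoid.inductionOn' with
    | one => simpa [MonoidAlgebra.one_def] using one
    | of_mul x u ih => rw [map_mul]; exact mul x _ ih
  have smul : ∀ (z : ℤ) (q : CDPoly), motive q → motive (z • q) := by
    intro z q hq
    induction z with
    | zero => simpa using zero
    | succ n ih => rw [add_smul, one_smul]; exact add _ _ ih hq
    | pred n ih => rw [sub_smul, one_smul, sub_eq_add_neg]; exact add _ _ ih (neg _ hq)
  exact MonoidAlgebra.induction_on p word add smul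

/-- By the Leibniz rule it suffices to check variables: `a + b ↦ ba + ab` and `ab + ba ↦ (a + b)(ab
+ ba)`. -/
theorem cdToAB_cdDer (p : CDPoly) : cdToAB (cdDer p) = abDer (cdToAB p) := by
  induction p using cdPoly_induction with
  | zero => simp
  | add p q hp hq => simp only [map_add, hp, hq]
  | neg p hp => simp only [map_neg, hp]
  | one => rw [cdDer_one, map_one, abDer_one, map_zero]
  | mul x p hp =>
    have hx : cdToAB (cdDer (cdVar x)) = abDer (cdToAB (cdVar x)) := by
      cases x
      · rw [cdDer_c, cdToAB_cdVar, cdToAB_cdVar]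
        simp only [cdLetterToAB, map_add, abDer_a, abDer_b]
        abel
      · rw [cdDer_d, map_mul, cdToAB_cdVar, cdToAB_cdVar]
        simp only [cdLetterToAB, map_add, abDer_a, abDer_b, abDer_mul]
        noncomm_ring
    rw [cdDer_mul, map_add, map_mul, map_mul, hp, hx, map_mul, abDer_mul]

/-- The `cd`-index of the Boolean lattice of rank `k + 1`. -/
def boolCD : ℕ → CDPoly
  | 0 => 1
  | k + 1 => boolCD k * cdVar .c + cdDer (boolCD k)

/-- The `ab`-polynomial of the Boolean lattice of rank `k + 1`. -/
def boolAB (k : ℕ) : ABPoly := cdToAB (boolCD k)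

theorem boolAB_zero : boolAB 0 = 1 := by simp [boolAB, boolCD]

theorem boolAB_succ (k : ℕ) :
    boolAB (k + 1) = boolAB k * (abVar .a + abVar .b) + abDer (boolAB k) := by
  simp only [boolAB, boolCD, map_add, map_mul, cdToAB_cdVar, cdToAB_cdDer, cdLetterToAB]

/-! ### Chain weights over Boolean lower intervals, and star sums -/

/-- The difference `a - b`. -/
def abDiff : ABPoly := abVar .a - abVar .b

/-- The derivation sends `a - b` to `ba - ab`, its commutator with `b`. Commutation with `b` is
itself a derivation, so the two agree on all powers. -/
theorem abDer_abDiff_pow (k : ℕ) :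
    abDer (abDiff ^ k) = abVar .b * abDiff ^ k - abDiff ^ k * abVar .b := by
  induction k with
  | zero => simp [abDer_one]
  | succ k ih =>
    rw [pow_succ, abDer_mul, ih, abDiff, map_sub, abDer_a, abDer_b]
    noncomm_ring

/-- The contribution to the `ab`-polynomial of length `n` of the chains whose largest element has
rank `s` and a Boolean lower interval. -/
def chainTerm (n : ℕ) : ℕ → ABPoly
  | 0 => abDiff ^ n
  | s + 1 => boolAB s * abVar .b * abDiff ^ (n - 1 - s)

/-- This is the effect of adjoining a vertex to the largest face. The commutator from the tail `(a -
b)^k` cancels the added right factor `b`, and the Boolean factor undergoes the pyramid recursion. -/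
theorem chainTerm_succ_succ (n s : ℕ) (hs : s ≤ n) :
    chainTerm (n + 1) (s + 1) = abDer (chainTerm n s) + chainTerm n s * abVar .b := by
  cases s with
  | zero => simp [chainTerm, boolAB_zero, abDer_abDiff_pow]
  | succ s =>
    simp only [chainTerm, boolAB_succ, abDer_mul, abDer_b, abDer_abDiff_pow]
    rw [show n + 1 - 1 - (s + 1) = n - 1 - s by omega]
    noncomm_ring

theorem chainTerm_succ (n s : ℕ) (hs : s ≤ n) :
    chainTerm (n + 1) s = chainTerm n s * abDiff := by
  cases s with
  | zero => simp [chainTerm, pow_succ]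
  | succ s =>
    simp only [chainTerm]
    rw [show n + 1 - 1 - s = (n - 1 - s) + 1 by omega, pow_succ]
    noncomm_ring

theorem chainTerm_top (n : ℕ) : chainTerm (n + 1) (n + 1) = boolAB n * abVar .b := by
  simp [chainTerm]

/-- The contribution of the chains whose largest element is a proper subset containing a given
`p`-subset of a set with `p + q` elements. -/
def starSum (n p q : ℕ) : ABPoly := ∑ k ∈ Finset.range q, q.choose k • chainTerm n (p + k)

theorem starSum_succ_left (n p q : ℕ) (h : p + q = n + 1) :
    starSum (n + 1) (p + 1) q = abDer (starSum n p q) + starSum n p q * abVar .b := by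
  simp only [starSum, map_sum, map_nsmul, Finset.sum_mul, ← Finset.sum_add_distrib]
  refine Finset.sum_congr rfl fun k hk => ?_
  rw [Finset.mem_range] at hk
  rw [show p + 1 + k = p + k + 1 by omega, chainTerm_succ_succ _ _ (by omega), smul_add,
    smul_mul_assoc]

theorem sum_range_succ_chainTerm (n p q : ℕ) (h : p + q = n + 1) :
    ∑ k ∈ Finset.range (q + 1), q.choose k • chainTerm (n + 1) (p + k)
      = starSum n p q * abDiff + boolAB n * abVar .b := by
  rw [Finset.sum_range_succ, h, chainTerm_top, Nat.choose_self, one_smul, starSum, Finset.sum_mul]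
  congr 1
  refine Finset.sum_congr rfl fun k hk => ?_
  rw [Finset.mem_range] at hk
  rw [chainTerm_succ _ _ (by omega), smul_mul_assoc]

/-- Pascal's rule, by singling out one free element. The subsets avoiding it may contain all other
elements, whence the extra term `boolAB n * b`; those containing it must still be proper. -/
theorem starSum_succ_right (n p q : ℕ) (h : p + q = n + 1) :
    starSum (n + 1) p (q + 1)
      = starSum n p q * abDiff + boolAB n * abVar .b + starSum (n + 1) (p + 1) q := by
  rw [← sum_range_succ_chainTerm n p q h, starSum, starSum, Finset.sum_range_succ', Finset.sum_range_succ' _ q, add_right_comm,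
    ← Finset.sum_add_distrib]
  simp only [Nat.choose_zero_right]
  congr 1
  refine Finset.sum_congr rfl fun k _ => ?_
  rw [Nat.choose_succ_succ, add_smul, add_comm, show p + 1 + k = p + (k + 1) by omega]

/-- This justifies the name of `boolAB`: the two splitting rules turn the chain expansion of a
Boolean lattice into the pyramid recursion. -/
theorem starSum_zero_left (n : ℕ) : starSum n 0 (n + 1) = boolAB n := by
  induction n with
  | zero => simp [starSum, chainTerm, boolAB_zero]
  | succ n ih =>
    rw [starSum_succ_right _ _ _ (by omega), starSum_succ_left _ _ _ (by omega), ih, boolAB_succ,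
      abDiff]
    noncomm_ring

/-- The polynomials `Φ̌_j^n` with `n = j + k + 1`. -/
def checkCD (j k : ℕ) : CDPoly := cdDer^[j] (boolCD k * cdVar .c)

/-- The right-hand side is the increment found in `semisuspensionAB_succ`. For `j = 0` the first
star sum is `boolAB k` and the second is empty; the splitting rules show that the derivation raises
`j` by one. -/
theorem cdToAB_checkCD (j k : ℕ) :
    cdToAB (checkCD j k) = starSum (j + k) j (k + 1) * abVar .a
      + (boolAB (j + k) - starSum (j + k) (k + 1) j) * abVar .b := by
  induction j with
  | zero =>
    rw [checkCD, Function.iterate_zero, id, map_mul, cdToAB_cdVar, cdLetterToAB, Nat.zero_add,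
      starSum_zero_left]
    simp [starSum, boolAB, mul_add]
  | succ j ih =>
    rw [checkCD, Function.iterate_succ_apply', ← checkCD, cdToAB_cdDer, ih,
      show j + 1 + k = j + k + 1 by omega, starSum_succ_left _ _ _ (by omega),
      starSum_succ_right _ _ _ (by omega), starSum_succ_left _ _ _ (by omega), boolAB_succ, abDiff]
    simp only [map_add, map_sub, abDer_mul, abDer_a, abDer_b]
    noncomm_ring

end

/-! ### Coefficientwise lower bounds -/

noncomputable section

/-- The polynomials with nonnegative coefficients. -/
def IsNonneg (p : CDPoly) : Prop := ∀ w, 0 ≤ p.coeff w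

theorem IsNonneg.zero : IsNonneg 0 := fun w => by simp

theorem IsNonneg.add {p q : CDPoly} (hp : IsNonneg p) (hq : IsNonneg q) : IsNonneg (p + q) :=
  fun w => by
    rw [MonoidAlgebra.coeff_add, Finsupp.add_apply]
    exact add_nonneg (hp w) (hq w)

theorem IsNonneg.nsmul {p : CDPoly} (hp : IsNonneg p) (k : ℕ) : IsNonneg (k • p) := by
  induction k with
  | zero => simpa using IsNonneg.zero
  | succ k ih => rw [succ_nsmul]; exact ih.add hp

theorem IsNonneg.of (w : CDMonomial) : IsNonneg (MonoidAlgebra.of ℤ CDMonomial w) := fun v => by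
  classical
  rw [MonoidAlgebra.of_apply, MonoidAlgebra.coeff_single, Finsupp.single_apply]
  split_ifs <;> simp

theorem IsNonneg.one : IsNonneg 1 := by
  rw [← map_one (MonoidAlgebra.of ℤ CDMonomial)]
  exact IsNonneg.of 1

theorem IsNonneg.cdVar (x : CDLetter) : IsNonneg (cdVar x) := IsNonneg.of _

theorem IsNonneg.sum {ι : Type*} {s : Finset ι} {f : ι → CDPoly} (h : ∀ i ∈ s, IsNonneg (f i)) :
    IsNonneg (∑ i ∈ s, f i) :=
  Finset.sum_induction f IsNonneg (fun _ _ => IsNonneg.add) IsNonneg.zero h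

theorem IsNonneg.eq_sum {p : CDPoly} (hp : IsNonneg p) :
    p = ∑ w ∈ p.coeff.support, (p.coeff w).toNat • MonoidAlgebra.of ℤ CDMonomial w := by
  conv_lhs => rw [← MonoidAlgebra.sum_coeff_single p]
  refine Finset.sum_congr rfl fun w _ => ?_
  rw [MonoidAlgebra.of_apply, MonoidAlgebra.smul_single]
  simp [Int.toNat_of_nonneg (hp w)]

theorem IsNonneg.mul {p q : CDPoly} (hp : IsNonneg p) (hq : IsNonneg q) : IsNonneg (p * q) := by
  rw [hp.eq_sum, hq.eq_sum, Finset.sum_mul_sum]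
  refine IsNonneg.sum fun u _ => IsNonneg.sum fun v _ => ?_
  rw [smul_mul_assoc, mul_smul_comm, ← map_mul]
  exact ((IsNonneg.of _).nsmul _).nsmul _

theorem IsNonneg.cdDer {p : CDPoly} (hp : IsNonneg p) : IsNonneg (cdDer p) := by
  have word : ∀ w : CDMonomial, IsNonneg (_root_.cdDer (MonoidAlgebra.of ℤ CDMonomial w)) := by
    intro w
    induction w using FreeMonoid.inductionOn' with
    | one => rw [map_one, cdDer_one]; exact IsNonneg.zero
    | of_mul x u ih =>
      rw [map_mul, cdDer_mul]
      refine ((IsNonneg.of _).mul ih).add (IsNonneg.mul ?_ (IsNonneg.of _))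
      cases x
      · exact cdDer_c ▸ IsNonneg.cdVar _
      · exact cdDer_d ▸ (IsNonneg.cdVar _).mul (IsNonneg.cdVar _)
  rw [hp.eq_sum, map_sum]
  refine IsNonneg.sum fun w _ => ?_
  rw [map_nsmul]
  exact (word w).nsmul _

theorem IsNonneg.coeff_le {p q : CDPoly} (h : IsNonneg (q - p)) (w : CDMonomial) :
    p.coeff w ≤ q.coeff w := by
  have := h w
  rw [MonoidAlgebra.coeff_sub, Finsupp.sub_apply] at this
  omega

/-! ### Comparison of the Boolean `cd`-index with `∑ 2^m w` -/

/-- The sum `∑ 2^m w` over all `cd`-monomials `w` of degree `k`, where `m` is the number of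
occurrences of `d` in `w`. -/
def powCD : ℕ → CDPoly
  | 0 => 1
  | 1 => cdVar .c
  | k + 2 => powCD (k + 1) * cdVar .c + 2 • (powCD k * cdVar .d)

theorem powCD_add_two (k : ℕ) :
    powCD (k + 2) = powCD (k + 1) * cdVar .c + 2 • (powCD k * cdVar .d) := rfl

theorem cdDegree_mul_of (w : CDMonomial) (x : CDLetter) :
    cdDegree (w * FreeMonoid.of x) = cdDegree w + x.deg := by
  simp [cdDegree]

theorem dCount_mul_of (w : CDMonomial) (x : CDLetter) :
    dCount (w * FreeMonoid.of x) = dCount w + if x = .d then 1 else 0 := by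
  cases x <;> simp [dCount]

theorem coeff_powCD (k : ℕ) (w : CDMonomial) (hw : cdDegree w = k) :
    (powCD k).coeff w = 2 ^ dCount w := by
  obtain ⟨l, rfl⟩ := FreeMonoid.ofList.surjective w
  induction l using List.reverseRecOn generalizing k with
  | nil =>
    have : k = 0 := by rw [← hw]; rfl
    subst this
    simp [powCD, dCount, MonoidAlgebra.one_def]
  | append_singleton l x ih =>
    rw [FreeMonoid.ofList_append, FreeMonoid.ofList_singleton] at hw ⊢
    rw [cdDegree_mul_of] at hw
    rw [dCount_mul_of]
    cases x with
    | c =>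
      simp only [CDLetter.deg] at hw
      match k with
      | 0 => omega
      | 1 =>
        have := ih 0 (by omega)
        rw [powCD, ← one_mul (cdVar .c), cdVar, coeff_mul_of_same]
        simpa [powCD] using this
      | k + 2 =>
        rw [powCD_add_two, MonoidAlgebra.coeff_add, Finsupp.add_apply, MonoidAlgebra.coeff_smul,
          Finsupp.smul_apply, cdVar, cdVar, coeff_mul_of_same, coeff_mul_of_ne (by simp),
          ih (k + 1) (by omega)]
        simp
    | d =>
      simp only [CDLetter.deg] at hw
      match k with
      | 0 => omega
      | 1 => omega
      | k + 2 =>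
        rw [powCD_add_two, MonoidAlgebra.coeff_add, Finsupp.add_apply, MonoidAlgebra.coeff_smul,
          Finsupp.smul_apply, cdVar, cdVar, coeff_mul_of_same, coeff_mul_of_ne (by simp),
          ih k (by omega)]
        simp [pow_succ, mul_comm]

theorem isNonneg_powCD : ∀ k, IsNonneg (powCD k)
  | 0 => IsNonneg.one
  | 1 => IsNonneg.cdVar _
  | k + 2 => ((isNonneg_powCD (k + 1)).mul (IsNonneg.cdVar _)).add
      (((isNonneg_powCD k).mul (IsNonneg.cdVar _)).nsmul 2)

/-- Differentiating the final `c` in the part `powCD k * c` of `powCD (k + 1)` already yields the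
subtracted term. -/
theorem cdDer_powCD_sub (k : ℕ) : IsNonneg (cdDer (powCD (k + 1)) - powCD k * cdVar .d) := by
  cases k with
  | zero => simpa [powCD, cdDer_c] using IsNonneg.zero
  | succ k =>
    have h : cdDer (powCD (k + 1 + 1)) - powCD (k + 1) * cdVar .d
        = cdDer (powCD (k + 1)) * cdVar .c
          + 2 • (cdDer (powCD k) * cdVar .d + powCD k * (cdVar .c * cdVar .d)) := by
      rw [powCD_add_two, map_add, map_nsmul, cdDer_mul, cdDer_mul, cdDer_c, cdDer_d]
      noncomm_ring
    rw [h]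
    exact ((isNonneg_powCD _).cdDer.mul (IsNonneg.cdVar _)).add
      ((((isNonneg_powCD _).cdDer.mul (IsNonneg.cdVar _)).add
        ((isNonneg_powCD _).mul ((IsNonneg.cdVar _).mul (IsNonneg.cdVar _)))).nsmul 2)

theorem two_nsmul_pyramid_powCD_sub (k : ℕ) :
    IsNonneg (2 • (cdDer (powCD k) + powCD k * cdVar .c) - powCD (k + 1)) := by
  cases k with
  | zero =>
    have h : 2 • (cdDer (powCD 0) + powCD 0 * cdVar .c) - powCD (0 + 1) = cdVar .c := by
      simp only [powCD, cdDer_one]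
      noncomm_ring
    rw [h]
    exact IsNonneg.cdVar _
  | succ k =>
    have h : 2 • (cdDer (powCD (k + 1)) + powCD (k + 1) * cdVar .c) - powCD (k + 1 + 1)
        = 2 • (cdDer (powCD (k + 1)) - powCD k * cdVar .d) + powCD (k + 1) * cdVar .c := by
      rw [powCD_add_two]
      noncomm_ring
    rw [h]
    exact ((cdDer_powCD_sub k).nsmul 2).add ((isNonneg_powCD _).mul (IsNonneg.cdVar _))

/-- Words ending in `c` and in `d` are compared separately; for the latter,
`two_nsmul_pyramid_powCD_sub` supplies the bound. -/
theorem pyramid_powCD_sub (k : ℕ) :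
    IsNonneg (powCD (k + 2) * cdVar .c + cdDer (powCD (k + 2)) - powCD (k + 3)) := by
  have h : powCD (k + 2) * cdVar .c + cdDer (powCD (k + 2)) - powCD (k + 3)
      = cdDer (powCD (k + 1)) * cdVar .c
        + (2 • (cdDer (powCD k) + powCD k * cdVar .c) - powCD (k + 1)) * cdVar .d := by
    rw [powCD_add_two (k + 1), powCD_add_two k, map_add, map_nsmul, cdDer_mul, cdDer_mul, cdDer_c,
      cdDer_d]
    noncomm_ring
  rw [h]
  exact ((isNonneg_powCD _).cdDer.mul (IsNonneg.cdVar _)).add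
    ((two_nsmul_pyramid_powCD_sub k).mul (IsNonneg.cdVar _))

/-- The induction starts in degree 3, where both sides are `c³ + 2cd + 2dc`; in degree 2 the bound
fails, since `c² + d` faces `c² + 2d`. The pyramid map preserves the coefficientwise order. -/
theorem boolCD_sub_powCD (k : ℕ) : IsNonneg (boolCD (k + 3) - powCD (k + 3)) := by
  induction k with
  | zero =>
    have h : boolCD 3 - powCD 3 = 0 := by
      simp only [boolCD, powCD, cdDer_mul, map_add, cdDer_one, cdDer_c, cdDer_d]
      noncomm_ring
    rw [h]
    exact IsNonneg.zero
  | succ k ih =>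
    have h : boolCD (k + 1 + 3) - powCD (k + 1 + 3)
        = (boolCD (k + 3) - powCD (k + 3)) * cdVar .c + cdDer (boolCD (k + 3) - powCD (k + 3))
          + (powCD (k + 1 + 2) * cdVar .c + cdDer (powCD (k + 1 + 2)) - powCD (k + 1 + 3)) := by
      rw [show k + 1 + 3 = k + 3 + 1 by omega, boolCD, map_sub]
      noncomm_ring
    rw [h]
    exact ((ih.mul (IsNonneg.cdVar _)).add ih.cdDer).add (pyramid_powCD_sub _)

theorem two_pow_le_coeff_boolCD (k : ℕ) (hk : 3 ≤ k) (w : CDMonomial) (hw : cdDegree w = k) :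
    2 ^ dCount w ≤ (boolCD k).coeff w := by
  obtain ⟨k, rfl⟩ := Nat.exists_eq_add_of_le' hk
  rw [← coeff_powCD _ w hw]
  exact (boolCD_sub_powCD k).coeff_le w

theorem isNonneg_boolCD (k : ℕ) : IsNonneg (boolCD k) := by
  induction k with
  | zero => exact IsNonneg.one
  | succ k ih => exact (ih.mul (IsNonneg.cdVar _)).add ih.cdDer

/-- Since `D(pc + qd) = D(p)c + (p + D(q) + qc)d`, the factor `q` follows the pyramid recursion up
to the nonnegative summand `p`, so it keeps dominating `boolCD`. -/
theorem checkCD_decomposition (j k : ℕ) : ∃ p q : CDPoly, IsNonneg p ∧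
    IsNonneg (q - boolCD (j + k)) ∧ checkCD (j + 1) k = p * cdVar .c + q * cdVar .d := by
  induction j with
  | zero =>
    refine ⟨cdDer (boolCD k), boolCD k, (isNonneg_boolCD k).cdDer, ?_, ?_⟩
    · rw [Nat.zero_add, sub_self]
      exact IsNonneg.zero
    · simp only [checkCD, Function.iterate_succ, Function.iterate_zero, Function.comp, id,
        cdDer_mul, cdDer_c]
      abel
  | succ j ih =>
    obtain ⟨p, q, hp, hq, h⟩ := ih
    refine ⟨cdDer p, p + cdDer q + q * cdVar .c, hp.cdDer, ?_, ?_⟩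
    · have h' : p + cdDer q + q * cdVar .c - boolCD (j + 1 + k)
          = p + (cdDer (q - boolCD (j + k)) + (q - boolCD (j + k)) * cdVar .c) := by
        rw [show j + 1 + k = j + k + 1 by omega, boolCD, map_sub]
        noncomm_ring
      rw [h']
      exact hp.add (hq.cdDer.add (hq.mul (IsNonneg.cdVar _)))
    · rw [checkCD, Function.iterate_succ_apply', ← checkCD, h, map_add, cdDer_mul, cdDer_mul,
        cdDer_c, cdDer_d]
      noncomm_ring

theorem two_pow_le_coeff_checkCD_zero (k : ℕ) (hk : 3 ≤ k) (w : CDMonomial)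
    (hw : cdDegree w = k) :
    2 ^ dCount w ≤ cdCoeff (w * FreeMonoid.of .c) (checkCD 0 k) := by
  rw [cdCoeff, checkCD, Function.iterate_zero, id, cdVar, coeff_mul_of_same]
  exact two_pow_le_coeff_boolCD k hk w hw

theorem two_pow_le_coeff_checkCD_succ (j k : ℕ) (hk : 3 ≤ j + k) (w : CDMonomial)
    (hw : cdDegree w = j + k) :
    2 ^ dCount w ≤ cdCoeff (w * FreeMonoid.of .d) (checkCD (j + 1) k) := by
  obtain ⟨p, q, -, hq, h⟩ := checkCD_decomposition j k
  rw [cdCoeff, h, MonoidAlgebra.coeff_add, Finsupp.add_apply, cdVar, cdVar, coeff_mul_of_same,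
    coeff_mul_of_ne (by simp), zero_add]
  exact (two_pow_le_coeff_boolCD _ hk w hw).trans (hq.coeff_le w)

end

/-! ### The `ab`-polynomial as a sum over chains -/

noncomputable section

/-- The product `v_1 ⋯ v_n` with `v_i = b` for `i ∈ S` and `v_i = a - b` otherwise. -/
def chainWeight (n : ℕ) (S : Finset ℕ) : ABPoly :=
  ((List.range' 1 n).map fun i => if i ∈ S then abVar .b else abDiff).prod

theorem chainWeight_succ (n : ℕ) (S : Finset ℕ) :
    chainWeight (n + 1) S = chainWeight n S * if n + 1 ∈ S then abVar .b else abDiff := by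
  simp [chainWeight, List.range'_1_concat, add_comm]

theorem abWord_succ (n : ℕ) (S : Finset ℕ) :
    abWord (n + 1) S = abWord n S * FreeMonoid.of (if n + 1 ∈ S then .b else .a) := by
  simp [abWord, List.range'_1_concat, FreeMonoid.ofList_append, add_comm]

theorem chainWeight_congr {n : ℕ} {S T : Finset ℕ} (h : ∀ i ∈ Finset.Icc 1 n, i ∈ S ↔ i ∈ T) :
    chainWeight n S = chainWeight n T := by
  rw [chainWeight, chainWeight]
  congr 1
  refine List.map_congr_left fun i hi => ?_
  rw [List.mem_range'_1] at hi
  have := h i (Finset.mem_Icc.2 ⟨by omega, by omega⟩)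
  simp only [this]

theorem abWord_congr {n : ℕ} {S T : Finset ℕ} (h : ∀ i ∈ Finset.Icc 1 n, i ∈ S ↔ i ∈ T) :
    abWord n S = abWord n T := by
  rw [abWord, abWord]
  congr 1
  refine List.map_congr_left fun i hi => ?_
  rw [List.mem_range'_1] at hi
  have := h i (Finset.mem_Icc.2 ⟨by omega, by omega⟩)
  simp only [this]

theorem chainWeight_empty (n : ℕ) : chainWeight n ∅ = abDiff ^ n := by
  simp [chainWeight]

theorem chainWeight_insert (r k : ℕ) (S : Finset ℕ) (hS : ∀ i ∈ S, i ≤ r) :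
    chainWeight (r + 1 + k) (insert (r + 1) S)
      = chainWeight r S * abVar .b * abDiff ^ k := by
  induction k with
  | zero =>
    rw [add_zero, chainWeight_succ, if_pos (Finset.mem_insert_self _ _), pow_zero, mul_one]
    congr 1
    refine chainWeight_congr fun i hi => ?_
    rw [Finset.mem_Icc] at hi
    rw [Finset.mem_insert]
    exact ⟨fun h => h.resolve_left (by omega), Or.inr⟩
  | succ k ih =>
    have h : r + 1 + k + 1 ∉ insert (r + 1) S := by
      rw [Finset.mem_insert]
      rintro (h | h)
      · omega
      · have := hS _ h
        omega
    rw [← add_assoc, chainWeight_succ, ih, if_neg h, pow_succ, ← mul_assoc]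

/-- The factor of position `i` in the expansion of `chainWeight n T` at the word of `S`. -/
def expansionSign (T S : Finset ℕ) (i : ℕ) : ℤ :=
  if i ∈ T then (if i ∈ S then 1 else 0) else if i ∈ S then -1 else 1

theorem chainWeight_eq_sum (n : ℕ) (T : Finset ℕ) :
    chainWeight n T = ∑ S ∈ (Finset.Icc 1 n).powerset,
      MonoidAlgebra.single (abWord n S) (∏ i ∈ Finset.Icc 1 n, expansionSign T S i) := by
  induction n with
  | zero => simp [chainWeight, abWord, MonoidAlgebra.one_def]
  | succ n ih =>
    have hn : n + 1 ∉ Finset.Icc 1 n := by simp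
    have hI : Finset.Icc 1 (n + 1) = insert (n + 1) (Finset.Icc 1 n) := by
      ext i
      simp only [Finset.mem_Icc, Finset.mem_insert]
      omega
    rw [hI, Finset.sum_powerset_insert hn, ← Finset.sum_add_distrib, chainWeight_succ, ih,
      Finset.sum_mul]
    refine Finset.sum_congr rfl fun S hS => ?_
    have hnS : n + 1 ∉ S := fun h => hn (Finset.mem_powerset.1 hS h)
    have hprod : ∏ i ∈ Finset.Icc 1 n, expansionSign T (insert (n + 1) S) i
        = ∏ i ∈ Finset.Icc 1 n, expansionSign T S i := by
      refine Finset.prod_congr rfl fun i hi => ?_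
      have : i ≠ n + 1 := fun h => hn (h ▸ hi)
      simp [expansionSign, Finset.mem_insert, this]
    have hword : abWord n (insert (n + 1) S) = abWord n S := by
      refine abWord_congr fun i hi => ?_
      have : i ≠ n + 1 := fun h => hn (h ▸ hi)
      simp [this]
    rw [Finset.prod_insert hn, Finset.prod_insert hn, hprod, abWord_succ, abWord_succ, hword,
      if_neg hnS, if_pos (Finset.mem_insert_self _ _)]
    by_cases hT : n + 1 ∈ T
    · simp [expansionSign, hT, hnS, abVar]
    · have h1 : expansionSign T S (n + 1) = 1 := by simp [expansionSign, hT, hnS]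
      have h2 : expansionSign T (insert (n + 1) S) (n + 1) = -1 := by simp [expansionSign, hT]
      rw [if_neg hT, h1, h2, one_mul, neg_one_mul, abDiff, mul_sub, abVar, abVar,
        MonoidAlgebra.of_apply, MonoidAlgebra.of_apply, MonoidAlgebra.single_mul_single,
        MonoidAlgebra.single_mul_single, mul_one, MonoidAlgebra.single_neg, sub_eq_add_neg]

theorem prod_expansionSign {n : ℕ} {T S : Finset ℕ} (hT : T ⊆ Finset.Icc 1 n)
    (hS : S ⊆ Finset.Icc 1 n) :
    ∏ i ∈ Finset.Icc 1 n, expansionSign T S i = if T ⊆ S then (-1) ^ (S \ T).card else 0 := by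
  split_ifs with h
  · rw [← Finset.prod_subset (s₁ := S \ T) (Finset.sdiff_subset.trans hS)]
    · rw [← Finset.prod_const]
      refine Finset.prod_congr rfl fun i hi => ?_
      rw [Finset.mem_sdiff] at hi
      simp [expansionSign, hi.1, hi.2]
    · intro i _ hi
      rw [Finset.mem_sdiff, not_and_not_right] at hi
      by_cases hiT : i ∈ T
      · simp [expansionSign, hiT, h hiT]
      · simp [expansionSign, hiT, mt hi hiT]
  · obtain ⟨i, hiT, hiS⟩ := Finset.not_subset.1 h
    exact Finset.prod_eq_zero (hT hiT) (by simp [expansionSign, hiT, hiS])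

/-! ### Largest elements of finite chains -/

section ChainMax

variable {P : Type*} [PartialOrder P] [BoundedOrder P]

variable [Fintype P]

open Classical in
/-- The chains in the open interval between the minimum and `x`. -/
def openChains (x : P) : Finset (Finset P) :=
  Finset.univ.filter fun C => IsChain (· ≤ ·) (C : Set P) ∧ ∀ y ∈ C, ⊥ < y ∧ y < x

theorem mem_openChains {x : P} {C : Finset P} :
    C ∈ openChains x ↔ IsChain (· ≤ ·) (C : Set P) ∧ ∀ y ∈ C, ⊥ < y ∧ y < x := by
  simp [openChains]

open Classical in
/-- The largest element of a nonempty finite chain, and the minimum for the empty chain. -/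
def chainMax (C : Finset P) : P :=
  if h : ∃ y, IsGreatest (C : Set P) y then h.choose else ⊥

theorem chainMax_eq {C : Finset P} {y : P} (h : IsGreatest (C : Set P) y) : chainMax C = y := by
  have h' : ∃ y, IsGreatest (C : Set P) y := ⟨y, h⟩
  rw [chainMax, dif_pos h']
  exact h'.choose_spec.unique h

theorem chainMax_empty : chainMax (∅ : Finset P) = ⊥ := by
  rw [chainMax, dif_neg]
  rintro ⟨y, hy⟩
  simpa using hy.1

theorem isGreatest_chainMax {C : Finset P} (hC : IsChain (· ≤ ·) (C : Set P))
    (hne : C.Nonempty) : IsGreatest (C : Set P) (chainMax C) := by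
  obtain ⟨y, hy⟩ := C.exists_maximal hne
  have h : IsGreatest (C : Set P) y := by
    refine ⟨hy.1, fun z hz => ?_⟩
    rcases hC.total hz hy.1 with h | h
    · exact h
    · exact hy.2 hz h
  rwa [chainMax_eq h]

end ChainMax

section ChainSum

variable {P : Type*} [PartialOrder P] [BoundedOrder P] [GradeMinOrder ℕ P]

variable (P) in
-- Expanding the factors `a - b` of the chain weights produces exactly the inclusion–exclusion signs
-- of `flagH`.
theorem abPolynomial_eq_sum_flagF :
    abPolynomial P = ∑ T ∈ (Finset.Icc 1 (innerRank P)).powerset,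
      flagF P T • chainWeight (innerRank P) T := by
  simp only [chainWeight_eq_sum, Finset.smul_sum]
  rw [Finset.sum_comm, abPolynomial]
  refine Finset.sum_congr rfl fun S hS => ?_
  rw [Finset.mem_powerset] at hS
  have h : flagH P S = ∑ T ∈ (Finset.Icc 1 (innerRank P)).powerset,
      flagF P T • ∏ i ∈ Finset.Icc 1 (innerRank P), expansionSign T S i := by
    rw [flagH, ← Finset.sum_subset (Finset.powerset_mono.2 hS)]
    · refine Finset.sum_congr rfl fun T hT => ?_
      rw [Finset.mem_powerset] at hT
      rw [prod_expansionSign (hT.trans hS) hS, if_pos hT, nsmul_eq_mul, mul_comm]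
    · intro T hT hTS
      rw [Finset.mem_powerset] at hT hTS
      rw [prod_expansionSign hT hS, if_neg hTS, smul_zero]
  rw [h]
  simp only [MonoidAlgebra.smul_single]
  exact map_sum (MonoidAlgebra.singleAddHom (abWord (innerRank P) S)) _ _

variable [Fintype P]

/-- The sum of the weights of the chains in the open interval between the minimum and `x`. -/
def chainSum (x : P) (m : ℕ) : ABPoly :=
  ∑ C ∈ openChains x, chainWeight m (C.image (grade ℕ))

theorem abPolynomial_eq_chainSum : abPolynomial P = chainSum (⊤ : P) (innerRank P) := by
  classical
  rw [abPolynomial_eq_sum_flagF, chainSum]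
  rw [← Finset.sum_fiberwise_of_maps_to (g := fun C : Finset P => C.image (grade ℕ))
    (t := (Finset.Icc 1 (innerRank P)).powerset)]
  · refine Finset.sum_congr rfl fun T hT => ?_
    rw [Finset.sum_congr rfl (g := fun _ => chainWeight (innerRank P) T),
      Finset.sum_const]
    · congr 1
      rw [flagF, Set.ncard_eq_toFinset_card']
      congr 1
      ext C
      simp only [Set.mem_toFinset, Set.mem_ofPred_eq, Finset.mem_filter, mem_openChains]
      refine ⟨fun ⟨hC, hCT⟩ => ⟨⟨hC, fun y hy => ?_⟩, hCT⟩, fun ⟨⟨hC, _⟩, hCT⟩ => ⟨hC, hCT⟩⟩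
      have hy' : grade ℕ y ∈ T := hCT ▸ Finset.mem_image_of_mem _ hy
      have hI := Finset.mem_Icc.1 (Finset.mem_powerset.1 hT hy')
      rw [innerRank] at hI
      refine ⟨bot_lt_iff_ne_bot.2 ?_, lt_top_iff_ne_top.2 ?_⟩
      · rintro rfl
        have : grade ℕ (⊥ : P) = ⊥ := grade_bot
        simp only [bot_eq_zero] at this
        omega
      · rintro rfl
        omega
    · intro C hC
      rw [(Finset.mem_filter.1 hC).2]
  · intro C hC
    rw [mem_openChains] at hC
    rw [Finset.mem_powerset]
    intro r hr
    obtain ⟨y, hy, rfl⟩ := Finset.mem_image.1 hr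
    have h1 := grade_strictMono (𝕆 := ℕ) (hC.2 y hy).1
    have h2 := grade_strictMono (𝕆 := ℕ) (hC.2 y hy).2
    rw [Finset.mem_Icc, innerRank]
    omega

open Classical in
/-- The contribution to a chain sum of length `m` of the chains with largest element `y`. -/
def chainMaxTerm (y : P) (m : ℕ) : ABPoly :=
  if y = ⊥ then abDiff ^ m
  else chainSum y (grade ℕ y - 1) * abVar .b * abDiff ^ (m - grade ℕ y)

open Classical in
-- Erasing `y` is a bijection onto the chains strictly between the minimum and `y`. In the weight,
-- `y` accounts for a letter `b`, followed only by factors `a - b`.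
theorem sum_openChains_chainMax_eq {x y : P} (hyx : y < x) {m : ℕ} (hm : grade ℕ y ≤ m) :
    ∑ C ∈ openChains x with chainMax C = y, chainWeight m (C.image (grade ℕ))
      = chainMaxTerm y m := by
  rw [chainMaxTerm]
  split_ifs with hy
  · subst hy
    have : (openChains x).filter (fun C => chainMax C = ⊥) = {∅} := by
      ext C
      rw [Finset.mem_filter, mem_openChains, Finset.mem_singleton]
      constructor
      · rintro ⟨⟨hC, hCx⟩, hmax⟩
        by_contra hne
        have := (isGreatest_chainMax hC (Finset.nonempty_iff_ne_empty.2 hne)).1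
        rw [hmax] at this
        exact lt_irrefl _ (hCx _ this).1
      · rintro rfl
        exact ⟨by simp, chainMax_empty⟩
    rw [this, Finset.sum_singleton, Finset.image_empty, chainWeight_empty]
  · rw [chainSum, Finset.sum_mul, Finset.sum_mul]
    have hg : ∀ C ∈ openChains x, chainMax C = y → IsGreatest (C : Set P) y := by
      intro C hC hmax
      rw [← hmax]
      refine isGreatest_chainMax (mem_openChains.1 hC).1 (Finset.nonempty_iff_ne_empty.2 ?_)
      rintro rfl
      exact hy (hmax ▸ chainMax_empty)
    have hlt : ∀ C ∈ openChains x, chainMax C = y → ∀ z ∈ C.erase y, z < y := by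
      intro C hC hmax z hz
      exact lt_of_le_of_ne ((hg C hC hmax).2 (Finset.mem_of_mem_erase hz))
        (Finset.ne_of_mem_erase hz)
    have hpos : 0 < grade ℕ y :=
      lt_of_le_of_lt (Nat.zero_le _) (grade_strictMono (𝕆 := ℕ) (bot_lt_iff_ne_bot.2 hy))
    refine Finset.sum_nbij' (fun C => C.erase y) (fun C => insert y C) ?_ ?_ ?_ ?_ ?_
    · intro C hC
      rw [Finset.mem_filter] at hC
      have hC' := mem_openChains.1 hC.1
      exact mem_openChains.2 ⟨hC'.1.mono (by simp), fun z hz =>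
        ⟨(hC'.2 z (Finset.mem_of_mem_erase hz)).1, hlt C hC.1 hC.2 z hz⟩⟩
    · intro C hC
      rw [mem_openChains] at hC
      rw [Finset.mem_filter, mem_openChains]
      refine ⟨⟨?_, ?_⟩, chainMax_eq ⟨by simp, ?_⟩⟩
      · rw [Finset.coe_insert]
        exact hC.1.insert fun z hz _ => Or.inr (hC.2 z hz).2.le
      · intro z hz
        rcases Finset.mem_insert.1 hz with rfl | hz
        · exact ⟨bot_lt_iff_ne_bot.2 hy, hyx⟩
        · exact ⟨(hC.2 z hz).1, (hC.2 z hz).2.trans hyx⟩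
      · intro z hz
        rcases Finset.mem_insert.1 hz with rfl | hz
        · exact le_rfl
        · exact (hC.2 z hz).2.le
    · intro C hC
      rw [Finset.mem_filter] at hC
      exact Finset.insert_erase (hg C hC.1 hC.2).1
    · intro C hC
      rw [mem_openChains] at hC
      exact Finset.erase_insert fun h => lt_irrefl _ (hC.2 y h).2
    · intro C hC
      rw [Finset.mem_filter] at hC
      conv_lhs => rw [← Finset.insert_erase (hg C hC.1 hC.2).1, Finset.image_insert]
      have h1 : grade ℕ y = grade ℕ y - 1 + 1 := by omega
      have h2 : m = grade ℕ y - 1 + 1 + (m - grade ℕ y) := by omega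
      conv_lhs => rw [h2, h1]
      rw [Nat.add_sub_cancel, chainWeight_insert, ← h1]
      intro r hr
      obtain ⟨z, hz, rfl⟩ := Finset.mem_image.1 hr
      have := grade_strictMono (𝕆 := ℕ) (hlt C hC.1 hC.2 z hz)
      omega

open Classical in
theorem chainSum_eq_sum {x : P} (hx : x ≠ ⊥) {m : ℕ} (hm : grade ℕ x ≤ m + 1) :
    chainSum x m = ∑ y : P, if y < x then chainMaxTerm y m else 0 := by
  rw [← Finset.sum_filter, chainSum, ← Finset.sum_fiberwise_of_maps_to (g := chainMax)
    (t := Finset.univ.filter (· < x))]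
  · refine Finset.sum_congr rfl fun y hy => sum_openChains_chainMax_eq (Finset.mem_filter.1 hy).2 ?_
    have := grade_strictMono (𝕆 := ℕ) (Finset.mem_filter.1 hy).2
    omega
  · intro C hC
    rw [Finset.mem_filter]
    refine ⟨Finset.mem_univ _, ?_⟩
    rcases C.eq_empty_or_nonempty with rfl | hne
    · rw [chainMax_empty]
      exact bot_lt_iff_ne_bot.2 hx
    · rw [mem_openChains] at hC
      exact (hC.2 _ (isGreatest_chainMax hC.1 hne).1).2

end ChainSum

end

/-! ### The `ab`-polynomial of a semisuspension -/

noncomputable section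

/-- The set of the first `m` vertices. -/
def initialVertices (n m : ℕ) : Finset (Fin (n + 1)) := Finset.univ.filter fun v => (v : ℕ) < m

theorem mem_initialVertices {n m : ℕ} {v : Fin (n + 1)} :
    v ∈ initialVertices n m ↔ (v : ℕ) < m := by
  simp [initialVertices]

theorem subset_simplexFacet_iff {n : ℕ} {F : Finset (Fin (n + 1))} {k : Fin (n + 1)} :
    F ⊆ simplexFacet n k ↔ k ∉ F := by
  simp [simplexFacet, Finset.subset_erase]

theorem mem_gammaFaces_iff {n : ℕ} {i : Fin n} {F : Finset (Fin (n + 1))} :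
    F ∈ gammaFaces n i ↔ ¬ initialVertices n (i + 1) ⊆ F := by
  rw [Finset.not_subset]
  simp only [gammaFaces, Set.mem_ofPred_eq, subset_simplexFacet_iff, mem_initialVertices,
    Nat.lt_succ_iff]

theorem eq_simplexFacet {n : ℕ} {H : Finset (Fin (n + 1))} {k : Fin (n + 1)} (hc : H.card = n)
    (hk : k ∉ H) : H = simplexFacet n k :=
  Finset.eq_of_subset_of_card_le (subset_simplexFacet_iff.2 hk)
    (by rw [LambdaPoset.card_simplexFacet, hc])

/-- A set of `n - 1` vertices misses two vertices `p`, `q` and lies only in the facets `σ_p`, `σ_q`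
of the simplex. Exactly one of these belongs to `Γ_i^n` when exactly one of `p`, `q` is among the
first `i + 1` vertices. -/
theorem mem_ballBoundary_iff {n : ℕ} {i : Fin n} {F : Finset (Fin (n + 1))} :
    F ∈ ballBoundary n (gammaFaces n i) ↔
      ¬ initialVertices n (i + 1) ⊆ F ∧ ¬ (initialVertices n (i + 1))ᶜ ⊆ F := by
  have hA : ∀ p, p ∈ initialVertices n (i + 1) → simplexFacet n p ∈ gammaFaces n i := by
    intro p hp
    rw [mem_initialVertices] at hp
    exact ⟨p, by omega, Finset.Subset.refl _⟩
  constructor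
  · rintro ⟨G, hG, hc, hFG, H, ⟨hH, hHc, hGH⟩, hu⟩
    rw [mem_gammaFaces_iff] at hG
    refine ⟨fun h => hG (h.trans hFG), fun h => ?_⟩
    -- If `F` contained all later vertices, both vertices missed by `G` would be initial and `G`
    -- would lie in two facets of `Γ_i^n`.
    have hcompl : Gᶜ.card = 2 := by
      rw [Finset.card_compl, Fintype.card_fin]
      omega
    obtain ⟨p, q, hpq, hGpq⟩ := Finset.card_eq_two.1 hcompl
    have hsub : ∀ r ∈ Gᶜ, r ∈ initialVertices n (i + 1) := by
      intro r hr
      by_contra hr'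
      exact Finset.mem_compl.1 hr (hFG (h (Finset.mem_compl.2 hr')))
    have hfacet : ∀ r ∈ Gᶜ, simplexFacet n r = H := fun r hr =>
      hu _ ⟨hA r (hsub r hr), LambdaPoset.card_simplexFacet r,
        subset_simplexFacet_iff.2 (Finset.mem_compl.1 hr)⟩
    have h1 := hfacet p (by simp [hGpq])
    have h2 := hfacet q (by simp [hGpq])
    have h3 : p ∈ simplexFacet n q := by simp [simplexFacet, hpq]
    rw [h2, ← h1] at h3
    simp [simplexFacet] at h3
  · rintro ⟨h1, h2⟩
    obtain ⟨p, hp, hpF⟩ := Finset.not_subset.1 h1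
    obtain ⟨q, hq, hqF⟩ := Finset.not_subset.1 h2
    rw [Finset.mem_compl] at hq
    have hpq : q ≠ p := by
      rintro rfl
      exact hq hp
    have hqmem : q ∈ simplexFacet n p := by simp [simplexFacet, hpq]
    have hsub : (simplexFacet n p).erase q ⊆ simplexFacet n p := Finset.erase_subset _ _
    refine ⟨(simplexFacet n p).erase q, LambdaPoset.gamma_mono hsub (hA p hp), ?_, ?_,
      simplexFacet n p, ⟨hA p hp, LambdaPoset.card_simplexFacet p, hsub⟩, ?_⟩
    · rw [Finset.card_erase_add_one hqmem, LambdaPoset.card_simplexFacet]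
    · exact Finset.subset_erase.2 ⟨subset_simplexFacet_iff.2 hpF, hqF⟩
    · rintro H ⟨hH, hHc, hGH⟩
      rw [mem_gammaFaces_iff] at hH
      obtain ⟨k, hk, hkH⟩ := Finset.not_subset.1 hH
      have hkp : k = p := by
        by_contra hkp
        refine hkH (hGH ?_)
        rw [Finset.mem_erase]
        refine ⟨?_, by simp [simplexFacet, hkp]⟩
        rintro rfl
        exact hq hk
      exact hkp ▸ eq_simplexFacet hHc hkH

/-! ### Chain sums in `P(Λ_i^n)` -/

section LambdaSums

variable {n : ℕ} {i : Fin n}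

instance : Fintype (LambdaPoset n i) := Fintype.ofFinite _

/-- The elements of `P(Λ_i^n)` are the faces of `Γ_i^n`, the cell and the maximum. -/
def lambdaEquiv : LambdaPoset n i ≃ Option (Option {F // F ∈ gammaFaces n i}) where
  toFun
    | .face F hF => some (some ⟨F, hF⟩)
    | .cell => some none
    | .top => none
  invFun
    | some (some F) => .face F.1 F.2
    | some none => .cell
    | none => .top
  left_inv x := by cases x <;> rfl
  right_inv x := by rcases x with _ | _ | _ <;> rfl

open Classical in
theorem sum_lambdaPoset {M : Type*} [AddCommMonoid M] (f : LambdaPoset n i → M)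
    (g : Finset (Fin (n + 1)) → M) (hfg : ∀ F hF, f (.face F hF) = g F) :
    ∑ x, f x = f .top + (f .cell + ∑ F with F ∈ gammaFaces n i, g F) := by
  rw [← lambdaEquiv.symm.sum_comp, Fintype.sum_option, Fintype.sum_option]
  congr 2
  rw [Finset.sum_subtype (p := (· ∈ gammaFaces n i)) _ (by simp)]
  exact Finset.sum_congr rfl fun F _ => hfg F.1 F.2

theorem grade_face (F : Finset (Fin (n + 1))) (hF : F ∈ gammaFaces n i) :
    grade ℕ (LambdaPoset.face F hF) = F.card := rfl

theorem grade_cell : grade ℕ (LambdaPoset.cell : LambdaPoset n i) = n := rfl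

theorem bot_eq_face :
    (⊥ : LambdaPoset n i) = .face ∅ LambdaPoset.empty_mem_gamma := rfl

theorem face_eq_bot_iff (F : Finset (Fin (n + 1))) (hF : F ∈ gammaFaces n i) :
    LambdaPoset.face F hF = ⊥ ↔ F = ∅ := by
  rw [bot_eq_face]
  simp

theorem face_lt_face_iff (F G : Finset (Fin (n + 1))) (hF : F ∈ gammaFaces n i)
    (hG : G ∈ gammaFaces n i) : LambdaPoset.face F hF < .face G hG ↔ F ⊂ G := Iff.rfl

theorem face_lt_cell_iff (F : Finset (Fin (n + 1))) (hF : F ∈ gammaFaces n i) :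
    LambdaPoset.face F hF < .cell ↔ F ∈ ballBoundary n (gammaFaces n i) :=
  ⟨fun h => h.le, fun h => lt_of_le_not_ge h LambdaPoset.not_cell_le_face⟩

theorem lt_top_of_ne {x : LambdaPoset n i} (h : x ≠ .top) : x < .top :=
  lt_of_le_of_ne (LambdaPoset.le_top' x) h

theorem sum_ssubsets_chainTerm {V : Type*} [DecidableEq V] (F : Finset V) (m : ℕ) :
    ∑ G ∈ F.ssubsets, chainTerm m G.card = starSum m 0 F.card := by
  have h := Finset.sum_powerset_apply_card (chainTerm m) (x := F)
  rw [Finset.sum_range_succ, Nat.choose_self, one_smul,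
    ← Finset.sum_erase_add _ _ (Finset.mem_powerset_self F)] at h
  simpa [starSum, Finset.ssubsets] using add_right_cancel h

/-- The chain sum below `F` is kept as a hypothesis so that the strong induction in `chainSum_face`
can supply it. -/
theorem chainMaxTerm_face_of_chainSum {F : Finset (Fin (n + 1))} (hF : F ∈ gammaFaces n i) (m : ℕ)
    (h : F ≠ ∅ → chainSum (LambdaPoset.face F hF) (F.card - 1) = boolAB (F.card - 1)) :
    chainMaxTerm (LambdaPoset.face F hF) m = chainTerm m F.card := by
  rw [chainMaxTerm]
  split_ifs with hb
  · rw [face_eq_bot_iff] at hb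
    simp [hb, chainTerm]
  · rw [face_eq_bot_iff] at hb
    rw [grade_face, h hb]
    obtain ⟨s, hs⟩ := Nat.exists_eq_succ_of_ne_zero
      (Finset.card_pos.2 (Finset.nonempty_iff_ne_empty.2 hb)).ne'
    rw [hs]
    simp only [Nat.succ_eq_add_one, chainTerm, Nat.add_sub_cancel]
    rw [Nat.sub_sub, add_comm 1 s]

theorem chainSum_face {F : Finset (Fin (n + 1))} (hF : F ∈ gammaFaces n i) (hne : F ≠ ∅) :
    chainSum (LambdaPoset.face F hF) (F.card - 1) = boolAB (F.card - 1) := by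
  classical
  induction F using Finset.strongInduction with
  | H F ih =>
    have hcard := Finset.card_pos.2 (Finset.nonempty_iff_ne_empty.2 hne)
    rw [chainSum_eq_sum (by rwa [Ne, face_eq_bot_iff]) (by rw [grade_face]; omega),
      sum_lambdaPoset _ (fun G => if G ⊂ F then chainTerm (F.card - 1) G.card else 0)]
    · have h1 : ¬ (LambdaPoset.top : LambdaPoset n i) < .face F hF := fun h =>
        LambdaPoset.not_top_le_face h.le
      have h2 : ¬ (LambdaPoset.cell : LambdaPoset n i) < .face F hF := fun h =>
        LambdaPoset.not_cell_le_face h.le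
      rw [if_neg h1, if_neg h2, zero_add, zero_add, ← Finset.sum_filter]
      have h3 : Finset.filter (· ⊂ F) (Finset.univ.filter (· ∈ gammaFaces n i)) = F.ssubsets := by
        ext G
        simp only [Finset.mem_filter, Finset.mem_univ, true_and, Finset.mem_ssubsets]
        exact ⟨fun h => h.2, fun h => ⟨LambdaPoset.gamma_mono h.1 hF, h⟩⟩
      rw [h3, sum_ssubsets_chainTerm]
      obtain ⟨s, hs⟩ := Nat.exists_eq_succ_of_ne_zero hcard.ne'
      rw [hs]
      exact starSum_zero_left s
    · intro G hG
      simp only [face_lt_face_iff]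
      split_ifs with h
      · exact chainMaxTerm_face_of_chainSum hG _ fun hG' => ih G h hG hG'
      · rfl

theorem chainMaxTerm_face (F : Finset (Fin (n + 1))) (hF : F ∈ gammaFaces n i) (m : ℕ) :
    chainMaxTerm (LambdaPoset.face F hF) m = chainTerm m F.card :=
  chainMaxTerm_face_of_chainSum hF m (chainSum_face hF)

open Classical in
theorem chainSum_cell :
    chainSum (LambdaPoset.cell : LambdaPoset n i) (n - 1)
      = ∑ F with F ∈ ballBoundary n (gammaFaces n i), chainTerm (n - 1) F.card := by
  rw [chainSum_eq_sum (by rw [bot_eq_face]; simp) (by rw [grade_cell]; omega),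
    sum_lambdaPoset _ (fun G => if G ∈ ballBoundary n (gammaFaces n i) then
      chainTerm (n - 1) G.card else 0)]
  · have h1 : ¬ (LambdaPoset.top : LambdaPoset n i) < .cell := fun h =>
      LambdaPoset.not_top_le_cell h.le
    rw [if_neg h1, if_neg (lt_irrefl _), zero_add, zero_add, ← Finset.sum_filter,
      Finset.filter_filter]
    refine Finset.sum_congr (Finset.filter_congr fun F _ => ?_) fun _ _ => rfl
    rw [mem_gammaFaces_iff, mem_ballBoundary_iff]
    tauto
  · intro G hG
    simp only [face_lt_cell_iff, chainMaxTerm_face]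

/-- The `ab`-polynomial of the semisuspension of the complex generated by the first `m` facets. -/
def semisuspensionAB (n m : ℕ) : ABPoly :=
  ∑ F with ¬ initialVertices n m ⊆ F, chainTerm n F.card
    + (∑ F with ¬ initialVertices n m ⊆ F ∧ ¬ (initialVertices n m)ᶜ ⊆ F,
        chainTerm (n - 1) F.card) * abVar .b

/-- The first sum collects the empty chain and the chains ending in a face, the second those ending
in the cell. The cell has rank `n`, so no factor `a - b` follows its `b`. -/
theorem abPolynomial_lambdaPoset :
    abPolynomial (LambdaPoset n i) = semisuspensionAB n (i + 1) := by
  classical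
  have hr : innerRank (LambdaPoset n i) = n := rfl
  have h0 : (⊤ : LambdaPoset n i) ≠ ⊥ := by
    intro h
    have h' : (LambdaPoset.top : LambdaPoset n i) = .face ∅ LambdaPoset.empty_mem_gamma := h
    simp at h'
  rw [abPolynomial_eq_chainSum, hr, chainSum_eq_sum h0 le_rfl,
    sum_lambdaPoset _ (fun G => chainTerm n G.card)]
  · have h1 : ¬ (LambdaPoset.top : LambdaPoset n i) < ⊤ := lt_irrefl _
    have h2 : (LambdaPoset.cell : LambdaPoset n i) < ⊤ := lt_top_of_ne (by simp)
    have h3 : (LambdaPoset.cell : LambdaPoset n i) ≠ ⊥ := by rw [bot_eq_face]; simp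
    rw [if_neg h1, if_pos h2, zero_add, chainMaxTerm, if_neg h3, grade_cell, chainSum_cell,
      Nat.sub_self, pow_zero, mul_one, add_comm, semisuspensionAB]
    simp only [mem_gammaFaces_iff, mem_ballBoundary_iff]
  · intro F hF
    have h1 : LambdaPoset.face F hF < ⊤ := lt_top_of_ne (by simp)
    rw [if_pos h1, chainMaxTerm_face]

end LambdaSums

/-! ### Adding one facet -/

theorem sum_Icc_chainTerm {V : Type*} [DecidableEq V] {A B : Finset V} (h : A ⊆ B) (m : ℕ) :
    ∑ F ∈ Finset.Icc A B, chainTerm m F.card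
      = ∑ k ∈ Finset.range (B.card - A.card + 1),
          (B.card - A.card).choose k • chainTerm m (A.card + k) := by
  rw [Finset.Icc_eq_image_powerset h, Finset.sum_image, ← Finset.card_sdiff_of_subset h,
    ← Finset.sum_powerset_apply_card fun k => chainTerm m (A.card + k)]
  · refine Finset.sum_congr rfl fun F hF => ?_
    rw [Finset.card_union_of_disjoint]
    exact Finset.disjoint_of_subset_right (Finset.mem_powerset.1 hF) Finset.disjoint_sdiff
  · intro F hF G hG hFG
    have hd : ∀ H ∈ (B \ A).powerset, (A ∪ H) \ A = H := fun H hH =>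
      Finset.union_sdiff_cancel_left
        (Finset.disjoint_of_subset_right (Finset.mem_powerset.1 hH) Finset.disjoint_sdiff)
    rw [← hd F hF, ← hd G hG]
    exact congrArg (· \ A) hFG

theorem card_initialVertices {n m : ℕ} (h : m ≤ n + 1) : (initialVertices n m).card = m := by
  rw [initialVertices, Fin.card_filter_val_lt]
  omega

/-- Without facets both sums are empty; this lets `Φ̌_0^n` count as an increment like the others. -/
theorem semisuspensionAB_zero (n : ℕ) : semisuspensionAB n 0 = 0 := by
  have h : initialVertices n 0 = ∅ := by simp [initialVertices]
  simp [semisuspensionAB, h]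

theorem semisuspensionAB_succ (j k : ℕ) :
    semisuspensionAB (j + k + 1) (j + 1)
      = semisuspensionAB (j + k + 1) j + cdToAB (checkCD j k) := by
  set n := j + k + 1 with hn
  set A := initialVertices n j with hA
  set A' := initialVertices n (j + 1) with hA'
  let v : Fin (n + 1) := ⟨j, by omega⟩
  have hvA : v ∉ A := by simp [hA, mem_initialVertices, v]
  have hins : A' = insert v A := by
    ext u
    rw [Finset.mem_insert, hA, hA', mem_initialVertices, mem_initialVertices, Fin.ext_iff]
    change (u : ℕ) < j + 1 ↔ (u : ℕ) = j ∨ (u : ℕ) < j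
    omega
  have hcA : A.card = j := card_initialVertices (by omega)
  have hcA' : A'.card = j + 1 := card_initialVertices (by omega)
  have hcB : (simplexFacet n v).card = n := LambdaPoset.card_simplexFacet v
  have hcC : A'ᶜ.card = k + 1 := by
    rw [Finset.card_compl, Fintype.card_fin, hcA']
    omega
  have hAB : A ⊆ simplexFacet n v := subset_simplexFacet_iff.2 hvA
  have hCB : A'ᶜ ⊆ simplexFacet n v :=
    subset_simplexFacet_iff.2 (by simp [hins])
  have hcompl : Aᶜ = insert v A'ᶜ := by
    ext u
    rw [Finset.mem_insert, Finset.mem_compl, Finset.mem_compl, hins, Finset.mem_insert]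
    by_cases hu : u = v
    · simp [hu, hvA]
    · simp [hu]
  -- The new faces are the sets containing `A` and missing `v`.
  have hfirst : ∑ F with ¬ A' ⊆ F, chainTerm n F.card
      = ∑ F with ¬ A ⊆ F, chainTerm n F.card
        + ∑ F ∈ Finset.Icc A (simplexFacet n v), chainTerm n F.card := by
    rw [← Finset.sum_union]
    · refine Finset.sum_congr ?_ fun _ _ => rfl
      ext F
      simp only [Finset.mem_filter, Finset.mem_univ, true_and, Finset.mem_union, Finset.mem_Icc,
        subset_simplexFacet_iff, hins, Finset.insert_subset_iff]
      tauto
    · rw [Finset.disjoint_left]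
      intro F hF hF'
      exact (Finset.mem_filter.1 hF).2 (Finset.mem_Icc.1 hF').1
  -- A set containing `v` contributes equally to both sides; a set missing `v` contributes exactly
  -- one term to each.
  have hsecond : ∑ F with ¬ A' ⊆ F ∧ ¬ A'ᶜ ⊆ F, chainTerm (n - 1) F.card
        + ∑ F ∈ Finset.Icc A'ᶜ (simplexFacet n v), chainTerm (n - 1) F.card
      = ∑ F with ¬ A ⊆ F ∧ ¬ Aᶜ ⊆ F, chainTerm (n - 1) F.card
        + ∑ F ∈ Finset.Icc A (simplexFacet n v), chainTerm (n - 1) F.card := by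
    have hIcc : ∀ D : Finset (Fin (n + 1)), Finset.Icc D (simplexFacet n v)
        = Finset.univ.filter fun F => D ⊆ F ∧ v ∉ F := by
      intro D
      ext F
      simp [subset_simplexFacet_iff]
    simp only [hIcc, Finset.sum_filter, ← Finset.sum_add_distrib]
    refine Finset.sum_congr rfl fun F _ => ?_
    simp only [hcompl, hins, Finset.insert_subset_iff]
    rw [← hins]
    by_cases h1 : v ∈ F <;> by_cases h2 : A ⊆ F <;> by_cases h3 : A'ᶜ ⊆ F <;> simp [h1, h2, h3]
  have hkey := sum_range_succ_chainTerm (j + k) j (k + 1) (by omega)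
  rw [sum_Icc_chainTerm hAB, hcA, hcB, show n - j = k + 1 by omega, hkey] at hfirst
  -- The top summand of either interval belongs to `σ_v`, whose size `n` exceeds the length `n - 1`.
  -- These two terms cancel, leaving star sums.
  rw [sum_Icc_chainTerm hAB, sum_Icc_chainTerm hCB, hcA, hcB, hcC, show n - j = k + 1 by omega,
    show n - (k + 1) = j by omega, show n - 1 = j + k by omega, Finset.sum_range_succ _ j,
    Finset.sum_range_succ _ (k + 1), ← starSum, ← starSum, Nat.choose_self, Nat.choose_self,
    show k + 1 + j = j + (k + 1) by omega, ← add_assoc, ← add_assoc, ← add_assoc, add_left_inj,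
    ← eq_sub_iff_add_eq] at hsecond
  rw [semisuspensionAB, semisuspensionAB, ← hA, ← hA', hfirst, show n - 1 = j + k by omega, hsecond,
    cdToAB_checkCD, abDiff]
  noncomm_ring

end

/-! ### The `cd`-indices of the semisuspensions -/

noncomputable section

/-- The `cd`-index of the semisuspension of the complex generated by the first `m` facets. -/
def semisuspensionCD (n m : ℕ) : CDPoly := ∑ j ∈ Finset.range m, checkCD j (n - 1 - j)

/-- The increments of `semisuspensionAB_succ` telescope from the empty complex. -/
theorem cdToAB_semisuspensionCD (n m : ℕ) (h : m ≤ n) :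
    cdToAB (semisuspensionCD n m) = semisuspensionAB n m := by
  induction m with
  | zero => simp [semisuspensionCD, semisuspensionAB_zero]
  | succ m ih =>
    obtain ⟨k, rfl⟩ := Nat.exists_eq_add_of_le h
    rw [semisuspensionCD, Finset.sum_range_succ, ← semisuspensionCD, map_add, ih (by omega),
      show m + 1 + k - 1 - m = k by omega, show m + 1 + k = m + k + 1 by omega,
      semisuspensionAB_succ]

theorem isCDIndex_lambdaPoset_iff {n : ℕ} {i : Fin n} {Φ : CDPoly} :
    IsCDIndex (LambdaPoset n i) Φ ↔ Φ = semisuspensionCD n (i + 1) := by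
  rw [IsCDIndex, abPolynomial_lambdaPoset, ← cdToAB_semisuspensionCD _ _ i.isLt]
  exact cdToAB_injective.eq_iff

theorem lambdaCDIndex_eq {n i : ℕ} (h : i < n) :
    lambdaCDIndex n i = semisuspensionCD n (i + 1) := by
  have hex : ∃ Φ, IsCDIndex (LambdaPoset n ⟨i, h⟩) Φ := ⟨_, isCDIndex_lambdaPoset_iff.2 rfl⟩
  rw [lambdaCDIndex, dif_pos h, cdIndex, dif_pos hex]
  exact isCDIndex_lambdaPoset_iff.1 hex.choose_spec

theorem checkPhi_eq {n j : ℕ} (h : j < n) : checkPhi n j = checkCD j (n - 1 - j) := by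
  rw [checkPhi, if_neg (by omega)]
  cases j with
  | zero => simp [lambdaCDIndex_eq h, semisuspensionCD]
  | succ j =>
    rw [if_neg (by omega), Nat.add_sub_cancel, lambdaCDIndex_eq h, lambdaCDIndex_eq (by omega),
      semisuspensionCD, semisuspensionCD, Finset.sum_range_succ, add_sub_cancel_left]

end

theorem mainTheorem7 (n : ℕ) (hn : 4 ≤ n) :
    (∀ i : Fin n, ∃! Φ : CDPoly, IsCDIndex (LambdaPoset n i) Φ) ∧
    ∀ w : CDMonomial,
      (cdDegree w = n - 1 →
        (2 : ℤ) ^ dCount w ≤ cdCoeff (w * FreeMonoid.of CDLetter.c) (checkPhi n 0)) ∧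
      (5 ≤ n → ∀ j : ℕ, 1 ≤ j → j ≤ n - 1 → cdDegree w = n - 2 →
        (2 : ℤ) ^ dCount w ≤ cdCoeff (w * FreeMonoid.of CDLetter.d) (checkPhi n j)) := by
  refine ⟨fun i => ⟨_, isCDIndex_lambdaPoset_iff.2 rfl, fun Φ hΦ =>
    isCDIndex_lambdaPoset_iff.1 hΦ⟩, fun w => ⟨fun hw => ?_, fun hn5 j hj hjn hw => ?_⟩⟩
  · rw [checkPhi_eq (by omega)]
    exact two_pow_le_coeff_checkCD_zero _ (by omega) w hw
  · obtain ⟨j, rfl⟩ := Nat.exists_eq_add_of_le' hj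
    rw [checkPhi_eq (by omega)]
    -- After the shift of `j` the two indices add up to `n - 2`, which is at least 3 because `5 ≤
    -- n`.
    exact two_pow_le_coeff_checkCD_succ j _ (by omega) w (by omega)
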